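/- For non-negative integers $s_1,\dots,s_6$ put $$\zeta_{\mathfrak{sl}(4)}(s_1,s_2,s_3,s_4,s_5,s_6)=\sum_{m_1,m_2,m_3=1}^{\infty}\frac{1}{m_1^{s_1}\,m_2^{s_2}\,m_3^{s_3}\,(m_1+m_2)^{s_4}\,(m_2+m_3)^{s_5}\,(m_1+m_2+m_3)^{s_6}}$$ whenever the series converges. For integers $s\ge 2$ and $t\ge 1$ define the single and double Euler sums $$\zeta(s)=\sum_{n>0}\frac{1}{n^{s}},\qquad \zeta(s,t)=\sum_{n_1>n_2>0}\frac{1}{n_1^{s}\,n_2^{t}}.$$ **Theorem 2.2.** Let $a,b,c,d,f$ be positive integers such that $a+b+c+d+f$ is even or $a+b+c+d+f\le 10$. Then the series defining the Witten multiple zeta value $\zeta_{\mathfrak{sl}(4)}(a,b,c,d,0,f)$ converges, and $\zeta_{\mathfrak{sl}(4)}(a,b,c,d,0,f)$ is a rational linear combination of (non-empty, finite) products of single and double Euler sums $\zeta(s)$, $\zeta(s,t)$ with integers $s\ge 2$, $t\ge 1$. -/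

import Mathlib

noncomputable section

/-- The general term, at positive integers `m₁, m₂, m₃` (packed as `m = (m₁, m₂, m₃)`), of the
Witten multiple zeta series of `𝔰𝔩(4)` at non-negative integer arguments; the arguments
are listed in the order `s₁₁, s₁₂, s₁₃, s₂₁, s₂₂, s₃₁`, where `s_{j,k}` is the exponent of
`m_k + ⋯ + m_{j+k-1}`. -/
def wittenSl4Term (s₁ s₂ s₃ s₄ s₅ s₆ : ℕ) (m : ℕ+ × ℕ+ × ℕ+) : ℝ :=
  1 / ((m.1 : ℝ) ^ s₁ * (m.2.1 : ℝ) ^ s₂ * (m.2.2 : ℝ) ^ s₃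
    * ((m.1 : ℝ) + (m.2.1 : ℝ)) ^ s₄
    * ((m.2.1 : ℝ) + (m.2.2 : ℝ)) ^ s₅
    * ((m.1 : ℝ) + (m.2.1 : ℝ) + (m.2.2 : ℝ)) ^ s₆)

/-- The Witten multiple zeta value of `𝔰𝔩(4)` at non-negative integer arguments
(meaningful when the series converges). -/
def wittenSl4 (s₁ s₂ s₃ s₄ s₅ s₆ : ℕ) : ℝ :=
  ∑' m : ℕ+ × ℕ+ × ℕ+, wittenSl4Term s₁ s₂ s₃ s₄ s₅ s₆ m

/-- The single Euler sum `ζ(s) = ∑_{n > 0} n⁻ˢ` (convergent for `2 ≤ s`). -/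
def singleEulerSum (s : ℕ) : ℝ :=
  ∑' n : ℕ+, 1 / (n : ℝ) ^ s

/-- The double Euler sum `ζ(s, t) = ∑_{n₁ > n₂ > 0} n₁⁻ˢ n₂⁻ᵗ`
(convergent for `2 ≤ s`, `1 ≤ t`). -/
def doubleEulerSum (s t : ℕ) : ℝ :=
  ∑' n : {n : ℕ+ × ℕ+ // n.2 < n.1}, 1 / ((n.1.1 : ℝ) ^ s * (n.1.2 : ℝ) ^ t)

/-- The set of all convergent single and double Euler sums with positive integer arguments. -/
def singleDoubleEulerSums : Set ℝ :=
  {x | ∃ s : ℕ, 2 ≤ s ∧ x = singleEulerSum s} ∪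
    {x | ∃ s t : ℕ, 2 ≤ s ∧ 1 ≤ t ∧ x = doubleEulerSum s t}

/-- The rational linear combinations of (non-empty, finite) products of single and double
Euler sums. The multiplicative subsemigroup generated by a set consists of the non-empty
finite products of its elements. -/
def eulerCombinations : Submodule ℚ ℝ :=
  Submodule.span ℚ (Subsemigroup.closure singleDoubleEulerSums : Set ℝ)

end

/-! Partial fractions turn the series into a non-negative integer combination of triple Euler sums
of the same weight: m₁ and m₂ are traded for m₁+m₂, then m₃ and m₁+m₂ for m₁+m₂+m₃
(`hasSum_witten`). What remains is `tripleZeta_mem`; exponents are shifted by one, so even weight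
means i+j+k odd.

If a triple sum were outside `eulerCombinations`, some ℚ-linear φ : ℝ → ℚ would kill that subspace
but not the sum. Expanding ζ(s+1)ζ(p+1,q+1) by shuffle and by stuffle, with Hoffman's relation
standing in for the divergent factor ζ(1), shows that φ of the triple sums satisfies the homogeneous
system `IsDoubleShuffle`. In weights 5, 7, 9 finite linear algebra gives only the zero solution. In
even weight the generating polynomial T is odd, and shuffle and stuffle become functional equations
for T whose combination forces T = 0 (`eq_zero_of_linearized_double_shuffle`). -/

open Finset

/-! ### Partial fractions. -/

/-- Partial sum of the negative binomial series, normalised: `∑_{i ≤ b} C(a+i, i) t^(a+1) r^i`. -/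
theorem negBinomial_step {t r : ℝ} (h : t + r = 1) (a b : ℕ) :
    ∑ i ∈ range (b + 1), ((a + 1 + i).choose i : ℝ) * (t ^ (a + 2) * r ^ i) =
      ∑ i ∈ range (b + 1), ((a + i).choose i : ℝ) * (t ^ (a + 1) * r ^ i)
        - ((a + b + 1).choose b : ℝ) * (t ^ (a + 1) * r ^ (b + 1)) := by
  obtain rfl : r = 1 - t := by linarith
  induction b with
  | zero => simp; ring
  | succ b ih =>
    rw [sum_range_succ, ih, sum_range_succ _ (b + 1)]
    have h1 : ((a + 1 + (b + 1)).choose (b + 1) : ℝ)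
        = ((a + b + 1).choose b : ℝ) + ((a + (b + 1)).choose (b + 1) : ℝ) := by
      rw [show a + 1 + (b + 1) = (a + b + 1) + 1 by ring, Nat.choose_succ_succ]
      push_cast; rfl
    rw [show a + (b + 1) + 1 = a + 1 + (b + 1) by ring, h1]
    ring

/-- For 0 ≤ t ≤ 1 the two sums are the probabilities that, with success probability t, a+1 successes
come before b+1 failures, and conversely. -/
theorem negBinomial_add {t r : ℝ} (h : t + r = 1) (a b : ℕ) :
    ∑ i ∈ range (b + 1), ((a + i).choose i : ℝ) * (t ^ (a + 1) * r ^ i)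
      + ∑ i ∈ range (a + 1), ((b + i).choose i : ℝ) * (r ^ (b + 1) * t ^ i) = 1 := by
  induction a with
  | zero =>
    have : ∑ i ∈ range (b + 1), ((0 + i).choose i : ℝ) * (t ^ (0 + 1) * r ^ i)
        = (∑ i ∈ range (b + 1), r ^ i) * (1 - r) := by
      rw [sum_mul]
      refine sum_congr rfl fun i _ => ?_
      simp; rw [← h]; ring
    rw [this, geom_sum_mul_neg]
    simp
  | succ a ih =>
    rw [negBinomial_step h, sum_range_succ _ (a + 1)]
    have : (b + (a + 1)).choose (a + 1) = (a + b + 1).choose b := by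
      rw [show a + b + 1 = b + (a + 1) by ring, Nat.choose_symm_add]
    rw [this]
    linear_combination ih

/-- Partial fraction decomposition of `1 / (x ^ (a+1) y ^ (b+1))` in terms of `x + y`. -/
theorem partialFraction {x y : ℝ} (hx : 0 < x) (hy : 0 < y) (a b : ℕ) :
    1 / (x ^ (a + 1) * y ^ (b + 1)) =
      ∑ i ∈ antidiagonal b, ((a + i.1).choose i.1 : ℝ)
          * (1 / ((x + y) ^ (a + i.1 + 1) * y ^ (i.2 + 1)))
      + ∑ i ∈ antidiagonal a, ((b + i.1).choose i.1 : ℝ)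
          * (1 / ((x + y) ^ (b + i.1 + 1) * x ^ (i.2 + 1))) := by
  have hs : x + y ≠ 0 := by positivity
  have h := negBinomial_add (t := x / (x + y)) (r := y / (x + y)) (by field_simp) a b
  have h' := congrArg (fun w => 1 / (x ^ (a + 1) * y ^ (b + 1)) * w) h
  simp only [mul_one] at h'
  rw [← h', mul_add, mul_sum, mul_sum,
    Nat.sum_antidiagonal_eq_sum_range_succ_mk, Nat.sum_antidiagonal_eq_sum_range_succ_mk]
  congr 1
  all_goals
    refine sum_congr rfl fun i hi => ?_
    have hi' := Nat.lt_succ_iff.1 (mem_range.1 hi)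
    obtain ⟨k, rfl⟩ := Nat.exists_eq_add_of_le hi'
    simp only [add_tsub_cancel_left]
    rw [div_pow, div_pow]
    field_simp
    ring

/-! ### Convergence of triple Euler sums. -/

theorem summable_pnat_rpow : Summable fun n : ℕ+ => (1 : ℝ) / (n : ℝ) ^ (4 / 3 : ℝ) := by
  have := (Real.summable_one_div_nat_rpow (p := 4 / 3)).2 (by norm_num)
  exact this.comp_injective PNat.coe_injective

theorem summable_triple_rpow : Summable fun m : ℕ+ × ℕ+ × ℕ+ => (1 : ℝ) /
    ((m.1 : ℝ) ^ (4 / 3 : ℝ) * ((m.2.1 : ℝ) ^ (4 / 3 : ℝ) * (m.2.2 : ℝ) ^ (4 / 3 : ℝ))) := by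
  have h := summable_pnat_rpow
  have h2 := h.mul_of_nonneg (h.mul_of_nonneg h (fun _ => by positivity) fun _ => by positivity)
    (fun _ => by positivity) (fun _ => by positivity)
  refine h2.congr fun m => ?_
  simp [mul_comm]

theorem one_le_coe_pnat (n : ℕ+) : (1 : ℝ) ≤ n := by
  exact_mod_cast n.pos

/-- Since (xyz)^(1/3) ≤ x+y+z, the smallest convergent exponents (2,1,1) are still dominated by a
product of three series with exponent 4/3 > 1. -/
theorem rpow_four_thirds_mul_le {x y z : ℝ} (hx : 1 ≤ x) (hy : 1 ≤ y) (hz : 1 ≤ z) :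
    x ^ (4 / 3 : ℝ) * (y ^ (4 / 3 : ℝ) * z ^ (4 / 3 : ℝ)) ≤ x * (x + y) * (x + y + z) ^ 2 := by
  have e : ∀ w : ℝ, 1 ≤ w → w ^ (4 / 3 : ℝ) = w * w ^ (1 / 3 : ℝ) := fun w hw => by
    rw [← Real.rpow_one_add' (by linarith) (by norm_num)]; norm_num
  have cube : (x + y + z) ^ (1 / 3 : ℝ) * (x + y + z) ^ (1 / 3 : ℝ) * (x + y + z) ^ (1 / 3 : ℝ)
      = x + y + z := by
    rw [← Real.rpow_add (by linarith), ← Real.rpow_add (by linarith)]; norm_num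
  rw [e x hx, e y hy, e z hz]
  have h1 : x ^ (1 / 3 : ℝ) ≤ (x + y + z) ^ (1 / 3 : ℝ) :=
    Real.rpow_le_rpow (by linarith) (by linarith) (by norm_num)
  have h2 : y ^ (1 / 3 : ℝ) ≤ (x + y + z) ^ (1 / 3 : ℝ) :=
    Real.rpow_le_rpow (by linarith) (by linarith) (by norm_num)
  have h3 : z ^ (1 / 3 : ℝ) ≤ (x + y + z) ^ (1 / 3 : ℝ) :=
    Real.rpow_le_rpow (by linarith) (by linarith) (by norm_num)
  calc x * x ^ (1 / 3 : ℝ) * (y * y ^ (1 / 3 : ℝ) * (z * z ^ (1 / 3 : ℝ)))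
      = x * y * z * (x ^ (1 / 3 : ℝ) * y ^ (1 / 3 : ℝ) * z ^ (1 / 3 : ℝ)) := by ring
    _ ≤ x * (x + y) * (x + y + z) * ((x + y + z) ^ (1 / 3 : ℝ) * (x + y + z) ^ (1 / 3 : ℝ)
          * (x + y + z) ^ (1 / 3 : ℝ)) := by gcongr <;> linarith
    _ = _ := by rw [cube]; ring

/-- The triple Euler sum `ζ(i+1, j+1, k+1)`, as a special Witten zeta value. -/
noncomputable def tripleZeta (i j k : ℕ) : ℝ := wittenSl4 (k + 1) 0 0 (j + 1) 0 (i + 1)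

theorem summable_triple {i : ℕ} (hi : 1 ≤ i) (j k : ℕ) :
    Summable (wittenSl4Term (k + 1) 0 0 (j + 1) 0 (i + 1)) := by
  refine Summable.of_nonneg_of_le (fun m => ?_) (fun m => ?_) summable_triple_rpow
  · unfold wittenSl4Term; positivity
  · obtain ⟨x, y, z⟩ := m
    have hx := one_le_coe_pnat x
    have hy := one_le_coe_pnat y
    have hz := one_le_coe_pnat z
    simp only [wittenSl4Term, pow_zero, mul_one]
    refine one_div_le_one_div_of_le (by positivity)
      ((rpow_four_thirds_mul_le hx hy hz).trans ?_)
    have h1 : (x : ℝ) ≤ x ^ (k + 1) := le_self_pow₀ hx (by omega)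
    have h2 : (x + y : ℝ) ≤ (x + y) ^ (j + 1) := le_self_pow₀ (by linarith) (by omega)
    have h3 : (x + y + z : ℝ) ^ 2 ≤ (x + y + z) ^ (i + 1) :=
      pow_le_pow_right₀ (by linarith) (by omega)
    gcongr

theorem hasSum_triple {i : ℕ} (hi : 1 ≤ i) (j k : ℕ) :
    HasSum (wittenSl4Term (k + 1) 0 0 (j + 1) 0 (i + 1)) (tripleZeta i j k) :=
  (summable_triple hi j k).hasSum

/-! ### Reduction to triple sums. -/

/-- `(m₁, m₂, m₃) ↦ (m₁, m₃, m₂)` -/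
def swapRight : ℕ+ × ℕ+ × ℕ+ ≃ ℕ+ × ℕ+ × ℕ+ :=
  (Equiv.refl _).prodCongr (Equiv.prodComm _ _)

/-- `(m₁, m₂, m₃) ↦ (m₂, m₁, m₃)` -/
def swapLeft : ℕ+ × ℕ+ × ℕ+ ≃ ℕ+ × ℕ+ × ℕ+ where
  toFun m := (m.2.1, m.1, m.2.2)
  invFun m := (m.2.1, m.1, m.2.2)
  left_inv _ := rfl
  right_inv _ := rfl

/-- The value of `∑ 1 / (m₁^(a+1) m₃^(c+1) (m₁+m₂+m₃)^(g+1))` in terms of triple sums. -/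
def splitValue {R : Type*} [CommSemiring R] (Z : ℕ → ℕ → ℕ → R) (a c g : ℕ) : R :=
  ∑ k ∈ antidiagonal a, ((c + k.1).choose k.1 : R) * Z g (c + k.1) k.2
    + ∑ k ∈ antidiagonal c, ((a + k.1).choose k.1 : R) * Z g (a + k.1) k.2

theorem hasSum_split {g : ℕ} (hg : 1 ≤ g) (a c : ℕ) :
    HasSum (wittenSl4Term (a + 1) 0 (c + 1) 0 0 (g + 1)) (splitValue tripleZeta a c g) := by
  have h1 : ∀ k ∈ antidiagonal a, HasSum (fun m => ((c + k.1).choose k.1 : ℝ) *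
      wittenSl4Term (k.2 + 1) 0 0 (c + k.1 + 1) 0 (g + 1) (swapRight m))
      (((c + k.1).choose k.1 : ℝ) * tripleZeta g (c + k.1) k.2) := fun k _ =>
    ((swapRight.hasSum_iff).2 (hasSum_triple hg _ _)).mul_left _
  have h2 : ∀ k ∈ antidiagonal c, HasSum (fun m => ((a + k.1).choose k.1 : ℝ) *
      wittenSl4Term (k.2 + 1) 0 0 (a + k.1 + 1) 0 (g + 1) (swapLeft (swapRight m)))
      (((a + k.1).choose k.1 : ℝ) * tripleZeta g (a + k.1) k.2) := fun k _ =>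
    (((swapRight.trans swapLeft).hasSum_iff).2 (hasSum_triple hg _ _)).mul_left _
  unfold splitValue
  convert (hasSum_sum h1).add (hasSum_sum h2) using 1
  funext ⟨x, y, z⟩
  have hx : (0 : ℝ) < x := by positivity
  have hz : (0 : ℝ) < z := by positivity
  have h := congrArg (fun w => w * (1 / (x + y + z : ℝ) ^ (g + 1))) (partialFraction hz hx c a)
  simp only [add_mul, sum_mul] at h
  simp only [wittenSl4Term, swapRight, swapLeft, Equiv.prodCongr_apply, Equiv.coe_fn_mk,
    Equiv.prodComm_apply, Prod.map, Equiv.refl_apply, Prod.swap, pow_zero, mul_one]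
  convert h using 1
  · rw [one_div_mul_one_div]; ring_nf
  · congr 1 <;> refine sum_congr rfl fun k _ => ?_
    all_goals
      conv_rhs => rw [mul_assoc, one_div_mul_one_div]
      ring_nf

/-- The value of `∑ 1 / (m₁^(q+1) m₃^(s+1) (m₁+m₂)^(p+1) (m₁+m₂+m₃)^f)` in terms of triple
sums. -/
def shuffleValue {R : Type*} [CommSemiring R] (Z : ℕ → ℕ → ℕ → R) (s p q f : ℕ) : R :=
  ∑ i ∈ antidiagonal p, ((s + i.1).choose i.1 : R) * Z (s + i.1 + f) i.2 q
    + ∑ i ∈ antidiagonal s, ((p + i.1).choose i.1 : R) * splitValue Z q i.2 (p + i.1 + f)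

/-- Partial fractions in m₃ and m₁+m₂. The extra exponent f serves three uses: 0 for products, 1 for
Hoffman's relation, and positive values for the Witten series. -/
theorem hasSum_shuffle {s p f : ℕ} (hs : 1 ≤ s + f) (hp : 1 ≤ p + f) (q : ℕ) :
    HasSum (wittenSl4Term (q + 1) 0 (s + 1) (p + 1) 0 f) (shuffleValue tripleZeta s p q f) := by
  have h1 : ∀ i ∈ antidiagonal p, HasSum (fun m => ((s + i.1).choose i.1 : ℝ) *
      wittenSl4Term (q + 1) 0 0 (i.2 + 1) 0 (s + i.1 + f + 1) m)
      (((s + i.1).choose i.1 : ℝ) * tripleZeta (s + i.1 + f) i.2 q) := fun i _ =>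
    (hasSum_triple (by omega) _ _).mul_left _
  have h2 : ∀ i ∈ antidiagonal s, HasSum (fun m => ((p + i.1).choose i.1 : ℝ) *
      wittenSl4Term (q + 1) 0 (i.2 + 1) 0 0 (p + i.1 + f + 1) m)
      (((p + i.1).choose i.1 : ℝ) * splitValue tripleZeta q i.2 (p + i.1 + f)) := fun i _ =>
    (hasSum_split (by omega) _ _).mul_left _
  rw [shuffleValue]
  convert (hasSum_sum h1).add (hasSum_sum h2) using 1
  funext ⟨x, y, z⟩
  have hx : (0 : ℝ) < x := by positivity
  have hy : (0 : ℝ) < y := by positivity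
  have hz : (0 : ℝ) < z := by positivity
  have h := congrArg (fun w => w * (1 / (x ^ (q + 1) * (x + y + z : ℝ) ^ f)))
    (partialFraction hz (add_pos hx hy) s p)
  simp only [add_mul, sum_mul] at h
  simp only [wittenSl4Term, pow_zero, mul_one]
  convert h using 1
  · rw [one_div_mul_one_div]; ring_nf
  · congr 1 <;> refine sum_congr rfl fun k _ => ?_
    all_goals
      conv_rhs => rw [mul_assoc, one_div_mul_one_div]
      ring_nf

theorem hasSum_witten (a b c d f : ℕ) :
    HasSum (wittenSl4Term (a + 1) (b + 1) (c + 1) (d + 1) 0 (f + 1))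
      (∑ i ∈ antidiagonal b, ((a + i.1).choose i.1 : ℝ)
          * shuffleValue tripleZeta c (d + (a + i.1) + 1) i.2 (f + 1)
        + ∑ i ∈ antidiagonal a, ((b + i.1).choose i.1 : ℝ)
          * shuffleValue tripleZeta c (d + (b + i.1) + 1) i.2 (f + 1)) := by
  have h1 : ∀ i ∈ antidiagonal b, HasSum (fun m => ((a + i.1).choose i.1 : ℝ) *
      wittenSl4Term (i.2 + 1) 0 (c + 1) (d + (a + i.1) + 1 + 1) 0 (f + 1) (swapLeft m))
      (((a + i.1).choose i.1 : ℝ) * shuffleValue tripleZeta c (d + (a + i.1) + 1) i.2 (f + 1)) :=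
    fun i _ => ((swapLeft.hasSum_iff).2 (hasSum_shuffle (by omega) (by omega) _)).mul_left _
  have h2 : ∀ i ∈ antidiagonal a, HasSum (fun m => ((b + i.1).choose i.1 : ℝ) *
      wittenSl4Term (i.2 + 1) 0 (c + 1) (d + (b + i.1) + 1 + 1) 0 (f + 1) m)
      (((b + i.1).choose i.1 : ℝ) * shuffleValue tripleZeta c (d + (b + i.1) + 1) i.2 (f + 1)) :=
    fun i _ => (hasSum_shuffle (by omega) (by omega) _).mul_left _
  convert (hasSum_sum h1).add (hasSum_sum h2) using 1
  funext ⟨x, y, z⟩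
  have hx : (0 : ℝ) < x := by positivity
  have hy : (0 : ℝ) < y := by positivity
  have hz : (0 : ℝ) < z := by positivity
  have h := congrArg (fun w => w * (1 / (z ^ (c + 1) * (x + y : ℝ) ^ (d + 1)
    * (x + y + z : ℝ) ^ (f + 1)))) (partialFraction hx hy a b)
  simp only [add_mul, sum_mul] at h
  simp only [wittenSl4Term, swapLeft, Equiv.coe_fn_mk, pow_zero, mul_one]
  convert h using 1
  · rw [one_div_mul_one_div]; ring_nf
  · congr 1 <;> refine sum_congr rfl fun k _ => ?_
    all_goals
      conv_rhs => rw [mul_assoc, one_div_mul_one_div]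
      ring_nf

/-! ### Stuffle and shuffle products. -/

theorem hasSum_of_trichotomy {ι : Type*} {F : ℕ+ × ℕ+ × ι → ℝ} {a b c : ℝ}
    (h₁ : HasSum (fun t : ℕ+ × ℕ+ × ι => F (t.1, t.1 + t.2.1, t.2.2)) a)
    (h₂ : HasSum (fun t : ℕ+ × ι => F (t.1, t.1, t.2)) b)
    (h₃ : HasSum (fun t : ℕ+ × ℕ+ × ι => F (t.1 + t.2.1, t.1, t.2.2)) c) :
    HasSum F (a + b + c) := by
  let e₁ : ℕ+ × ℕ+ × ι → ℕ+ × ℕ+ × ι := fun t => (t.1, t.1 + t.2.1, t.2.2)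
  let e₂ : ℕ+ × ι → ℕ+ × ℕ+ × ι := fun t => (t.1, t.1, t.2)
  let e₃ : ℕ+ × ℕ+ × ι → ℕ+ × ℕ+ × ι := fun t => (t.1 + t.2.1, t.1, t.2.2)
  have i₁ : Function.Injective e₁ := by
    rintro ⟨x, y, i⟩ ⟨x', y', i'⟩ h
    simp only [e₁, Prod.mk.injEq] at h
    obtain ⟨rfl, h, rfl⟩ := h
    simpa using h
  have i₂ : Function.Injective e₂ := by
    rintro ⟨x, i⟩ ⟨x', i'⟩ h
    simp only [e₂, Prod.mk.injEq] at h
    obtain ⟨rfl, -, rfl⟩ := h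
    rfl
  have i₃ : Function.Injective e₃ := by
    rintro ⟨x, y, i⟩ ⟨x', y', i'⟩ h
    simp only [e₃, Prod.mk.injEq] at h
    obtain ⟨h, rfl, rfl⟩ := h
    simpa using h
  have r₁ : Set.range e₁ = {t | t.1 < t.2.1} := by
    ext ⟨x, y, i⟩
    simp only [e₁, Set.mem_range, Prod.exists, Prod.mk.injEq, Set.mem_ofPred_eq]
    constructor
    · rintro ⟨x', y', i', rfl, rfl, rfl⟩
      exact PNat.lt_add_right _ _
    · intro h
      exact ⟨x, y - x, i, rfl, PNat.add_sub_of_lt h, rfl⟩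
  have r₂ : Set.range e₂ = {t | t.1 = t.2.1} := by
    ext ⟨x, y, i⟩
    simp only [e₂, Set.mem_range, Prod.exists, Prod.mk.injEq, Set.mem_ofPred_eq]
    constructor
    · rintro ⟨x', i', rfl, rfl, rfl⟩
      rfl
    · rintro rfl
      exact ⟨x, i, rfl, rfl, rfl⟩
  have r₃ : Set.range e₃ = {t | t.2.1 < t.1} := by
    ext ⟨x, y, i⟩
    simp only [e₃, Set.mem_range, Prod.exists, Prod.mk.injEq, Set.mem_ofPred_eq]
    constructor
    · rintro ⟨x', y', i', rfl, rfl, rfl⟩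
      exact PNat.lt_add_right _ _
    · intro h
      exact ⟨y, x - y, i, PNat.add_sub_of_lt h, rfl, rfl⟩
  have s₁ := (i₁.hasSum_range_iff (f := F)).2 h₁
  have s₂ := (i₂.hasSum_range_iff (f := F)).2 h₂
  have s₃ := (i₃.hasSum_range_iff (f := F)).2 h₃
  have d₁₂ : Disjoint (Set.range e₁) (Set.range e₂) := by
    rw [r₁, r₂, Set.disjoint_left]
    exact fun t (h : t.1 < t.2.1) => h.ne
  have c₃ : IsCompl (Set.range e₁ ∪ Set.range e₂) (Set.range e₃) := by
    rw [r₁, r₂, r₃, show {t : ℕ+ × ℕ+ × ι | t.2.1 < t.1}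
      = ({t | t.1 < t.2.1} ∪ {t | t.1 = t.2.1})ᶜ from ?_]
    · exact isCompl_compl
    · ext t
      simp only [Set.mem_ofPred_eq, Set.mem_compl_iff, Set.mem_union, ← le_iff_lt_or_eq, not_le]
  exact (s₁.add_disjoint d₁₂ s₂).add_isCompl c₃ s₃

/-- `(m₁, m₂, m₃) ↦ (m₂, m₃, m₁)` -/
def rotate : ℕ+ × ℕ+ × ℕ+ ≃ ℕ+ × ℕ+ × ℕ+ where
  toFun m := (m.2.1, m.2.2, m.1)
  invFun m := (m.2.2, m.1, m.2.1)
  left_inv _ := rfl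
  right_inv _ := rfl

/-- With n₂ < n₁, the cases are m < n₂, m = n₂, n₂ < m < n₁, m = n₁ and m > n₁. -/
theorem hasSum_stuffle_cases {G : ℕ+ → ℕ+ → ℕ+ → ℝ} {a₁ a₂ a₃ a₄ a₅ : ℝ}
    (h₁ : HasSum (fun t : ℕ+ × ℕ+ × ℕ+ => G t.1 (t.1 + t.2.1) (t.1 + t.2.1 + t.2.2)) a₁)
    (h₂ : HasSum (fun t : ℕ+ × ℕ+ => G t.1 t.1 (t.1 + t.2)) a₂)
    (h₃ : HasSum (fun t : ℕ+ × ℕ+ × ℕ+ => G (t.1 + t.2.1) t.1 (t.1 + t.2.1 + t.2.2)) a₃)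
    (h₄ : HasSum (fun t : ℕ+ × ℕ+ => G (t.1 + t.2) t.1 (t.1 + t.2)) a₄)
    (h₅ : HasSum (fun t : ℕ+ × ℕ+ × ℕ+ => G (t.1 + t.2.1 + t.2.2) t.1 (t.1 + t.2.1)) a₅) :
    HasSum (fun t : ℕ+ × ℕ+ × ℕ+ => G t.1 t.2.1 (t.2.1 + t.2.2)) (a₁ + a₂ + (a₃ + a₄ + a₅)) := by
  refine hasSum_of_trichotomy h₁ h₂ ?_
  -- For m > n₂, the second trichotomy compares the gaps m − n₂ and n₁ − n₂, moved to the first two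
  -- coordinates.
  rw [← rotate.symm.hasSum_iff]
  refine hasSum_of_trichotomy (F := (fun t : ℕ+ × ℕ+ × ℕ+ => G (t.1 + t.2.1) t.1 (t.1 + t.2.2))
    ∘ rotate.symm) ?_ ?_ ?_
  · rw [← rotate.hasSum_iff]
    simpa [Function.comp_def, rotate, add_assoc] using h₃
  · rw [← (Equiv.prodComm ℕ+ ℕ+).hasSum_iff]
    simpa [Function.comp_def, rotate, add_assoc] using h₄
  · rw [← rotate.hasSum_iff]
    simpa [Function.comp_def, rotate, add_assoc] using h₅

theorem hasSum_singleEulerSum {s : ℕ} (hs : 1 ≤ s) :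
    HasSum (fun n : ℕ+ => 1 / (n : ℝ) ^ (s + 1)) (singleEulerSum (s + 1)) :=
  (((Real.summable_one_div_nat_pow (p := s + 1)).2 (by omega)).comp_injective
    PNat.coe_injective).hasSum

theorem summable_double {p : ℕ} (hp : 1 ≤ p) (q : ℕ) :
    Summable fun t : ℕ+ × ℕ+ => 1 / ((t.1 + t.2 : ℝ) ^ (p + 1) * (t.1 : ℝ) ^ (q + 1)) := by
  -- The slice m₃ = 1 of this triple series is the double series.
  have h := (hasSum_shuffle (s := 1) (p := p) (f := 0) (by omega) (by omega) q).summable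
  have hi : Function.Injective fun t : ℕ+ × ℕ+ => (t.1, t.2, (1 : ℕ+)) := by
    rintro ⟨x, y⟩ ⟨x', y'⟩ h
    simpa using h
  refine (h.comp_injective hi).congr fun t => ?_
  simp [wittenSl4Term, mul_comm]

/-- Ordered pairs `n₂ < n₁` parametrised by `n₂` and `n₁ - n₂`. -/
def gapEquiv : ℕ+ × ℕ+ ≃ {n : ℕ+ × ℕ+ // n.2 < n.1} where
  toFun t := ⟨(t.1 + t.2, t.1), PNat.lt_add_right _ _⟩
  invFun n := (n.1.2, n.1.1 - n.1.2)
  left_inv t := by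
    ext
    · rfl
    · exact (congrArg (· - t.1) (add_comm t.1 t.2)).trans PNat.add_sub
  right_inv n := by
    obtain ⟨⟨x, y⟩, h⟩ := n
    ext
    · simp [PNat.add_sub_of_lt h]
    · rfl

theorem hasSum_double {p : ℕ} (hp : 1 ≤ p) (q : ℕ) :
    HasSum (fun t : ℕ+ × ℕ+ => 1 / ((t.1 + t.2 : ℝ) ^ (p + 1) * (t.1 : ℝ) ^ (q + 1)))
      (doubleEulerSum (p + 1) (q + 1)) := by
  have h : doubleEulerSum (p + 1) (q + 1)
      = ∑' t : ℕ+ × ℕ+, 1 / ((t.1 + t.2 : ℝ) ^ (p + 1) * (t.1 : ℝ) ^ (q + 1)) := by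
    rw [doubleEulerSum, ← gapEquiv.tsum_eq]
    simp [gapEquiv]
  rw [h]
  exact (summable_double hp q).hasSum

theorem single_mul_double_eq_shuffle {s p : ℕ} (hs : 1 ≤ s) (hp : 1 ≤ p) (q : ℕ) :
    singleEulerSum (s + 1) * doubleEulerSum (p + 1) (q + 1) = shuffleValue tripleZeta s p q 0 := by
  have h := rotate.hasSum_iff.2 (hasSum_shuffle (s := s) (p := p) (f := 0) (by omega) (by omega) q)
  have e : (fun t : ℕ+ × ℕ+ × ℕ+ => (1 / (t.1 : ℝ) ^ (s + 1)) *
      (1 / ((t.2.1 + t.2.2 : ℝ) ^ (p + 1) * (t.2.1 : ℝ) ^ (q + 1))))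
      = wittenSl4Term (q + 1) 0 (s + 1) (p + 1) 0 0 ∘ rotate := by
    funext t
    simp [wittenSl4Term, rotate]
    ring
  exact ((hasSum_singleEulerSum hs).mul (hasSum_double hp q) (e ▸ h.summable)).unique (e ▸ h)

theorem single_mul_double_eq_stuffle {s p : ℕ} (hs : 1 ≤ s) (hp : 1 ≤ p) (q : ℕ) :
    singleEulerSum (s + 1) * doubleEulerSum (p + 1) (q + 1) =
      tripleZeta p q s + doubleEulerSum (p + 1) (q + s + 1 + 1) + (tripleZeta p s q +
        doubleEulerSum (p + s + 1 + 1) (q + 1) + tripleZeta s p q) := by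
  have h := hasSum_stuffle_cases (G := fun m n₂ n₁ => (1 / (m : ℝ) ^ (s + 1)) *
      (1 / ((n₁ : ℝ) ^ (p + 1) * (n₂ : ℝ) ^ (q + 1))))
    (a₁ := tripleZeta p q s) (a₂ := doubleEulerSum (p + 1) (q + s + 1 + 1))
    (a₃ := tripleZeta p s q) (a₄ := doubleEulerSum (p + s + 1 + 1) (q + 1))
    (a₅ := tripleZeta s p q) ?_ ?_ ?_ ?_ ?_
  · simp only [PNat.add_coe, Nat.cast_add] at h
    exact ((hasSum_singleEulerSum hs).mul (hasSum_double hp q) h.summable).unique h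
  · convert hasSum_triple hp q s using 1
    funext t
    simp only [wittenSl4Term, PNat.add_coe, Nat.cast_add, pow_zero, mul_one, one_div, mul_inv,
      ← inv_pow]
    ring
  · convert hasSum_double hp (q + s + 1) using 1
    funext t
    simp only [PNat.add_coe, Nat.cast_add, one_div, mul_inv,
      ← inv_pow]
    ring
  · convert hasSum_triple hp s q using 1
    funext t
    simp only [wittenSl4Term, PNat.add_coe, Nat.cast_add, pow_zero, mul_one, one_div, mul_inv,
      ← inv_pow]
    ring
  · convert hasSum_double (p := p + s + 1) (by omega) q using 1
    funext t
    simp only [PNat.add_coe, Nat.cast_add, one_div, mul_inv,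
      ← inv_pow]
    ring
  · convert hasSum_triple hs p q using 1
    funext t
    simp only [wittenSl4Term, PNat.add_coe, Nat.cast_add, pow_zero, mul_one, one_div, mul_inv,
      ← inv_pow]
    ring

/-! ### Hoffman's relation. -/

theorem hasSum_inv_sub_inv_add (n : ℕ) :
    HasSum (fun i : ℕ => 1 / (i + 1 : ℝ) - 1 / (i + 1 + n : ℝ))
      (∑ j ∈ range n, 1 / (j + 1 : ℝ)) := by
  induction n with
  | zero => simp [hasSum_zero]
  | succ n ih =>
    rw [sum_range_succ]
    have h : HasSum (fun i : ℕ => 1 / (i + 1 + n : ℝ) - 1 / (i + 1 + (n + 1) : ℝ))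
        (1 / (n + 1 : ℝ)) := by
      rw [hasSum_iff_tendsto_nat_of_nonneg]
      · have e : ∀ N : ℕ, ∑ i ∈ range N, (1 / (i + 1 + n : ℝ) - 1 / (i + 1 + (n + 1) : ℝ))
            = 1 / (n + 1 : ℝ) - 1 / ((N : ℝ) + (n + 1)) := fun N => by
          have := sum_range_sub' (fun i : ℕ => 1 / (i + 1 + n : ℝ)) N
          rw [← show (1 / ((0 : ℕ) + 1 + n : ℝ)) = 1 / (n + 1 : ℝ) by simp [add_comm],
            show (N : ℝ) + (n + 1) = N + 1 + n by ring, ← this]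
          refine sum_congr rfl fun i _ => ?_
          push_cast
          ring
        simp only [e]
        have t : Filter.Tendsto (fun N : ℕ => 1 / ((N : ℝ) + (n + 1))) Filter.atTop (nhds 0) :=
          (Filter.tendsto_atTop_add_const_right _ _
            tendsto_natCast_atTop_atTop).const_div_atTop 1
        simpa using t.const_sub (1 / (n + 1 : ℝ))
      · intro i
        rw [sub_nonneg]
        exact one_div_le_one_div_of_le (by positivity) (by linarith)
    convert ih.add h using 1
    funext i
    push_cast
    ring

/-- The term is 1/m − 1/(n+m). This harmonic number is also the sum of 1/m over m ≤ n, which links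
the two sides of Hoffman's relation. -/
theorem hasSum_inv_mul_add (n : ℕ+) :
    HasSum (fun m : ℕ+ => n / ((m : ℝ) * (n + m : ℝ))) (∑ j ∈ range n, 1 / (j + 1 : ℝ)) := by
  rw [← Equiv.pnatEquivNat.symm.hasSum_iff]
  convert hasSum_inv_sub_inv_add n using 1
  funext i
  have : (0 : ℝ) < n := by positivity
  simp [Equiv.pnatEquivNat]
  field_simp
  ring

theorem hasSum_inv_of_le (n : ℕ+) :
    HasSum (fun m : ℕ+ => if m ≤ n then 1 / (m : ℝ) else 0) (∑ j ∈ range n, 1 / (j + 1 : ℝ)) := by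
  rw [← Equiv.pnatEquivNat.symm.hasSum_iff]
  convert (hasSum_sum_of_ne_finset_zero (s := range n) ?_ : HasSum _ _) using 1
  · refine sum_congr rfl fun i hi => ?_
    have : Nat.succPNat i ≤ n := by
      rw [← PNat.coe_le_coe]; simpa [Nat.succ_le_iff] using hi
    simp [Equiv.pnatEquivNat, this]
  · intro i hi
    have : ¬ Nat.succPNat i ≤ n := by
      rw [← PNat.coe_le_coe]; simpa [Nat.succ_le_iff] using hi
    simp [Equiv.pnatEquivNat, this]

/-- Hoffman's relation for `ζ(p+2, q+1)`. -/
theorem hoffman_relation (p q : ℕ) :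
    shuffleValue tripleZeta 0 p q 1 =
      tripleZeta (p + 1) q 0 + doubleEulerSum (p + 1 + 1) (q + 1 + 1) +
        (tripleZeta (p + 1) 0 q + doubleEulerSum (p + 2 + 1) (q + 1) + 0) := by
  -- The truncation m ≤ n₁ removes the divergent case m > n₁, hence `a₅ = 0`.
  have h := hasSum_stuffle_cases (G := fun m n₂ n₁ =>
      (1 / ((n₁ : ℝ) ^ (p + 2) * (n₂ : ℝ) ^ (q + 1))) * if m ≤ n₁ then 1 / (m : ℝ) else 0)
    (a₁ := tripleZeta (p + 1) q 0) (a₂ := doubleEulerSum (p + 1 + 1) (q + 1 + 1))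
    (a₃ := tripleZeta (p + 1) 0 q) (a₄ := doubleEulerSum (p + 2 + 1) (q + 1))
    (a₅ := 0) ?_ ?_ ?_ ?_ ?_
  · have h' := ((Equiv.prodAssoc ℕ+ ℕ+ ℕ+).trans rotate.symm).hasSum_iff.2 h
    have k' := (Equiv.prodAssoc ℕ+ ℕ+ ℕ+).hasSum_iff.2
      (hasSum_shuffle (s := 0) (p := p) (f := 1) (by omega) (by omega) q)
    refine (k'.prod_fiberwise (g := fun t => (1 / ((t.1 + t.2 : ℝ) ^ (p + 2)
      * (t.1 : ℝ) ^ (q + 1))) * ∑ j ∈ range (t.1 + t.2 : ℕ+), 1 / (j + 1 : ℝ)) ?_).unique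
      (h'.prod_fiberwise ?_)
    · rintro ⟨x, y⟩
      refine Eq.mp (congrArg (HasSum · _) (funext fun z => ?_)) ((hasSum_inv_mul_add (x + y)).mul_left
        (1 / ((x + y : ℝ) ^ (p + 2) * (x : ℝ) ^ (q + 1))))
      have : (0 : ℝ) < x := by positivity
      have : (0 : ℝ) < z := by positivity
      simp [wittenSl4Term]
      field_simp
      ring
    · rintro ⟨x, y⟩
      refine Eq.mp (congrArg (HasSum · _) (funext fun z => ?_)) ((hasSum_inv_of_le (x + y)).mul_left
        (1 / ((x + y : ℝ) ^ (p + 2) * (x : ℝ) ^ (q + 1))))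
      simp [rotate]
  · convert hasSum_triple (i := p + 1) (by omega) q 0 using 1
    funext t
    have : t.1 ≤ t.1 + t.2.1 + t.2.2 := by rw [add_assoc]; exact (PNat.lt_add_right _ _).le
    simp only [this, if_true, wittenSl4Term, PNat.add_coe, Nat.cast_add, pow_zero, mul_one, one_div, mul_inv,
      ← inv_pow]
    ring
  · convert hasSum_double (p := p + 1) (by omega) (q + 1) using 1
    funext t
    have : t.1 ≤ t.1 + t.2 := (PNat.lt_add_right _ _).le
    simp only [this, if_true, PNat.add_coe, Nat.cast_add, one_div, mul_inv,
      ← inv_pow]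
    ring
  · convert hasSum_triple (i := p + 1) (by omega) 0 q using 1
    funext t
    have : t.1 + t.2.1 ≤ t.1 + t.2.1 + t.2.2 := (PNat.lt_add_right _ _).le
    simp only [this, if_true, wittenSl4Term, PNat.add_coe, Nat.cast_add, pow_zero, mul_one, one_div, mul_inv,
      ← inv_pow]
    ring
  · convert hasSum_double (p := p + 2) (by omega) q using 1
    funext t
    simp only [PNat.add_coe, le_refl, if_true, Nat.cast_add, one_div, mul_inv,
      ← inv_pow]
    ring
  · convert hasSum_zero using 1
    funext t
    have : ¬ t.1 + t.2.1 + t.2.2 ≤ t.1 + t.2.1 := not_le.2 (PNat.lt_add_right _ _)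
    simp [this]

/-! ### Homogeneous relations and small odd weights. -/

/-- Double shuffle relations in depth three modulo products and sums of lower depth. -/
structure IsDoubleShuffle (z : ℕ → ℕ → ℕ → ℚ) : Prop where
  stuffle : ∀ s p q, 1 ≤ s → 1 ≤ p → z p q s + (z p s q + z s p q) = 0
  shuffle : ∀ s p q, 1 ≤ s → 1 ≤ p → shuffleValue z s p q 0 = 0
  hoffman : ∀ p q, shuffleValue z 0 p q 1 = z (p + 1) q 0 + z (p + 1) 0 q

/-- Here, and in weights 7 and 9, the chosen relations are as many as the unknowns (3, 10, 21) and
determine them. -/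
theorem IsDoubleShuffle.weight_five {z : ℕ → ℕ → ℕ → ℚ} (H : IsDoubleShuffle z) {i j k : ℕ}
    (hi : 1 ≤ i) (hw : i + j + k = 2) : z i j k = 0 := by
  have h0 := H.stuffle 1 1 0 (by simp) (by simp)
  have h1 := H.hoffman 0 1
  have h2 := H.hoffman 1 0
  simp [shuffleValue, splitValue, Nat.antidiagonal_succ, Nat.choose] at h1 h2
  obtain rfl : k = 2 - i - j := by omega
  have hi' : i ≤ 2 := by omega
  have hj : j ≤ 2 - i := by omega
  clear hw
  interval_cases i <;> interval_cases j <;> norm_num only <;> linarith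

theorem IsDoubleShuffle.weight_seven {z : ℕ → ℕ → ℕ → ℚ} (H : IsDoubleShuffle z) {i j k : ℕ}
    (hi : 1 ≤ i) (hw : i + j + k = 4) : z i j k = 0 := by
  have h0 := H.stuffle 1 1 2 (by simp) (by simp)
  have h1 := H.stuffle 1 2 1 (by simp) (by simp)
  have h2 := H.stuffle 2 2 0 (by simp) (by simp)
  have h3 := H.stuffle 1 3 0 (by simp) (by simp)
  have h4 := H.hoffman 0 3
  have h5 := H.hoffman 1 2
  have h6 := H.hoffman 2 1
  have h7 := H.hoffman 3 0
  have h8 := H.shuffle 1 2 1 (by simp) (by simp)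
  have h9 := H.shuffle 1 3 0 (by simp) (by simp)
  simp [shuffleValue, splitValue, Nat.antidiagonal_succ, Nat.choose] at h4 h5 h6 h7 h8 h9
  obtain rfl : k = 4 - i - j := by omega
  have hi' : i ≤ 4 := by omega
  have hj : j ≤ 4 - i := by omega
  clear hw
  interval_cases i <;> interval_cases j <;> norm_num only <;> linarith

theorem IsDoubleShuffle.weight_nine {z : ℕ → ℕ → ℕ → ℚ} (H : IsDoubleShuffle z) {i j k : ℕ}
    (hi : 1 ≤ i) (hw : i + j + k = 6) : z i j k = 0 := by
  have h0 := H.stuffle 2 2 2 (by simp) (by simp)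
  have h1 := H.stuffle 1 1 4 (by simp) (by simp)
  have h2 := H.stuffle 1 4 1 (by simp) (by simp)
  have h3 := H.stuffle 3 3 0 (by simp) (by simp)
  have h4 := H.stuffle 1 2 3 (by simp) (by simp)
  have h5 := H.stuffle 1 3 2 (by simp) (by simp)
  have h6 := H.stuffle 1 5 0 (by simp) (by simp)
  have h7 := H.stuffle 2 3 1 (by simp) (by simp)
  have h8 := H.stuffle 2 4 0 (by simp) (by simp)
  have h9 := H.hoffman 0 5
  have h10 := H.hoffman 1 4
  have h11 := H.hoffman 2 3
  have h12 := H.hoffman 3 2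
  have h13 := H.hoffman 4 1
  have h14 := H.hoffman 5 0
  have h15 := H.shuffle 1 4 1 (by simp) (by simp)
  have h16 := H.shuffle 1 5 0 (by simp) (by simp)
  have h17 := H.shuffle 1 3 2 (by simp) (by simp)
  have h18 := H.shuffle 2 3 1 (by simp) (by simp)
  have h19 := H.shuffle 2 4 0 (by simp) (by simp)
  have h20 := H.shuffle 1 2 3 (by simp) (by simp)
  simp [shuffleValue, splitValue, Nat.antidiagonal_succ, Nat.choose] at h9 h10 h11 h12 h13 h14 h15 h16 h17 h18 h19 h20
  obtain rfl : k = 6 - i - j := by omega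
  have hi' : i ≤ 6 := by omega
  have hj : j ≤ 6 - i := by omega
  clear hw
  interval_cases i <;> interval_cases j <;> norm_num only <;> linarith

/-! ### Generating polynomials. -/

/-- Generating polynomial of the values `Z i j k` with `i + j + k = n`. -/
def tripleGen (Z : ℕ → ℕ → ℕ → ℚ) (n : ℕ) (x y z : ℚ) : ℚ :=
  ∑ u ∈ antidiagonal n, ∑ v ∈ antidiagonal u.2, Z u.1 v.1 v.2 * (x ^ u.1 * y ^ v.1 * z ^ v.2)

theorem add_pow_antidiagonal (x y : ℚ) (n : ℕ) :
    (x + y) ^ n = ∑ a ∈ antidiagonal n, ((a.1 + a.2).choose a.1 : ℚ) * (x ^ a.1 * y ^ a.2) := by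
  rw [(Commute.all x y).add_pow']
  refine sum_congr rfl fun a ha => ?_
  rw [HasAntidiagonal.mem_antidiagonal.1 ha, nsmul_eq_mul]

theorem tripleGen_first (Z : ℕ → ℕ → ℕ → ℚ) (n : ℕ) (x y z : ℚ) :
    tripleGen Z n (x + y) y z = ∑ u ∈ antidiagonal n, ∑ v ∈ antidiagonal u.2,
      (∑ i ∈ antidiagonal v.1, ((u.1 + i.1).choose i.1 : ℚ) * Z (u.1 + i.1) i.2 v.2)
        * (x ^ u.1 * y ^ v.1 * z ^ v.2) := by
  simp only [tripleGen, add_pow_antidiagonal, mul_sum, sum_mul]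
  simp only [sum_sigma']
  -- The new pair records how the exponent of y splits between (x+y)^a and y^c.
  refine sum_nbij' (fun t => ⟨(t.2.2.1, t.2.2.2 + t.1.2), (t.2.2.2 + t.2.1.1, t.2.1.2),
      (t.2.2.2, t.2.1.1)⟩)
    (fun t => ⟨(t.1.1 + t.2.2.1, t.2.2.2 + t.2.1.2), (t.2.2.2, t.2.1.2), (t.1.1, t.2.2.1)⟩)
    ?_ ?_ ?_ ?_ ?_
  all_goals
    rintro ⟨⟨a, b⟩, ⟨⟨c, d⟩, ⟨e, f⟩⟩⟩ h
    simp only [mem_sigma, HasAntidiagonal.mem_antidiagonal] at h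
    obtain ⟨h1, h2, h3⟩ := h
    try simp only at h1 h2 h3
    subst h1 h2 h3
  · simp [add_comm, add_left_comm]
  · simp [add_comm, add_left_comm]
  · rfl
  · simp [add_assoc]
  · rw [Nat.choose_symm_add (a := e) (b := f)]
    ring

theorem tripleGen_second (Z : ℕ → ℕ → ℕ → ℚ) (n : ℕ) (x y z : ℚ) :
    tripleGen Z n (x + y) (x + z) z = ∑ u ∈ antidiagonal n, ∑ v ∈ antidiagonal u.2,
      (∑ i ∈ antidiagonal u.1, ((v.1 + i.1).choose i.1 : ℚ) *
        ∑ k ∈ antidiagonal v.2, ((i.2 + k.1).choose k.1 : ℚ) * Z (v.1 + i.1) (i.2 + k.1) k.2)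
        * (x ^ u.1 * y ^ v.1 * z ^ v.2) := by
  simp only [tripleGen, add_pow_antidiagonal, sum_mul_sum]
  simp only [mul_sum, sum_mul]
  simp only [sum_sigma']
  refine sum_nbij' (fun t => ⟨(t.2.2.1.1 + t.2.2.2.1, t.2.2.1.2 + (t.2.2.2.2 + t.2.1.2)),
      (t.2.2.1.2, t.2.2.2.2 + t.2.1.2), (t.2.2.1.1, t.2.2.2.1), (t.2.2.2.2, t.2.1.2)⟩)
    (fun t => ⟨(t.2.1.1 + t.2.2.1.1, t.2.2.1.2 + t.2.1.2),
      (t.2.2.1.2 + t.2.2.2.1, t.2.2.2.2), (t.2.2.1.1, t.2.1.1), (t.2.2.1.2, t.2.2.2.1)⟩)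
    ?_ ?_ ?_ ?_ ?_
  all_goals
    rintro ⟨⟨a, b⟩, ⟨⟨c, d⟩, ⟨⟨e, f⟩, ⟨k, l⟩⟩⟩⟩ h
    simp only [mem_sigma, HasAntidiagonal.mem_antidiagonal] at h
    obtain ⟨h1, h2, h3, h4⟩ := h
    try simp only at h1 h2 h3 h4
    subst h1 h2 h3 h4
  · simp [add_comm, add_left_comm]
  · simp [add_comm, add_left_comm]
  · simp [add_comm, add_left_comm]
  · simp
  · rw [Nat.choose_symm_add (a := k) (b := l), add_comm f e]
    ring

theorem tripleGen_third (Z : ℕ → ℕ → ℕ → ℚ) (n : ℕ) (x y z : ℚ) :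
    tripleGen Z n (x + y) (x + z) x = ∑ u ∈ antidiagonal n, ∑ v ∈ antidiagonal u.2,
      (∑ i ∈ antidiagonal u.1, ((v.1 + i.1).choose i.1 : ℚ) *
        ∑ k ∈ antidiagonal i.2, ((v.2 + k.1).choose k.1 : ℚ) * Z (v.1 + i.1) (v.2 + k.1) k.2)
        * (x ^ u.1 * y ^ v.1 * z ^ v.2) := by
  simp only [tripleGen, add_pow_antidiagonal, sum_mul_sum]
  simp only [mul_sum, sum_mul]
  simp only [sum_sigma']
  refine sum_nbij' (fun t => ⟨(t.2.2.1.1 + (t.2.2.2.1 + t.2.1.2), t.2.2.1.2 + t.2.2.2.2),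
      (t.2.2.1.2, t.2.2.2.2), (t.2.2.1.1, t.2.2.2.1 + t.2.1.2), (t.2.2.2.1, t.2.1.2)⟩)
    (fun t => ⟨(t.2.1.1 + t.2.2.1.1, t.2.1.2 + t.2.2.1.2),
      (t.2.1.2 + t.2.2.2.1, t.2.2.2.2), (t.2.2.1.1, t.2.1.1), (t.2.2.2.1, t.2.1.2)⟩)
    ?_ ?_ ?_ ?_ ?_
  all_goals
    rintro ⟨⟨a, b⟩, ⟨⟨c, d⟩, ⟨⟨e, f⟩, ⟨k, l⟩⟩⟩⟩ h
    simp only [mem_sigma, HasAntidiagonal.mem_antidiagonal] at h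
    obtain ⟨h1, h2, h3, h4⟩ := h
    try simp only at h1 h2 h3 h4
    subst h1 h2 h3 h4
  · simp [add_comm, add_left_comm]
  · simp [add_comm, add_left_comm]
  · simp [add_comm, add_left_comm]
  · simp
  · rw [add_comm f e, add_comm l k]
    ring

/-- The three substitutions give the first sum of `shuffleValue` and the two halves of `splitValue`.
-/
theorem tripleGen_shuffle (Z : ℕ → ℕ → ℕ → ℚ) (n : ℕ) (x y z : ℚ) :
    tripleGen Z n (x + y) y z + tripleGen Z n (x + y) (x + z) z
      + tripleGen Z n (x + y) (x + z) x = ∑ u ∈ antidiagonal n, ∑ v ∈ antidiagonal u.2,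
        shuffleValue Z u.1 v.1 v.2 0 * (x ^ u.1 * y ^ v.1 * z ^ v.2) := by
  rw [tripleGen_first, tripleGen_second, tripleGen_third, ← sum_add_distrib, ← sum_add_distrib]
  refine sum_congr rfl fun u _ => ?_
  rw [← sum_add_distrib, ← sum_add_distrib]
  refine sum_congr rfl fun v _ => ?_
  rw [← add_mul, ← add_mul, add_assoc, ← sum_add_distrib, shuffleValue]
  simp only [splitValue, ← mul_add, add_zero]

theorem eq_zero_of_sum_antidiagonal {n : ℕ} {c : ℕ → ℕ → ℚ}
    (h : ∀ x : ℚ, ∑ u ∈ antidiagonal n, c u.1 u.2 * x ^ u.1 = 0) {i j : ℕ} (hij : i + j = n) :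
    c i j = 0 := by
  let P : Polynomial ℚ := ∑ u ∈ antidiagonal n, Polynomial.monomial u.1 (c u.1 u.2)
  have hP : P = 0 := Polynomial.funext fun x => by
    simp [P, Polynomial.eval_finsetSum, h]
  have h' := congrArg (Polynomial.coeff · i) hP
  simp only [P, Polynomial.finsetSum_coeff, Polynomial.coeff_monomial, Polynomial.coeff_zero] at h'
  rw [sum_eq_single (i, j)] at h'
  · simpa using h'
  · rintro ⟨a, b⟩ hab hne
    rw [HasAntidiagonal.mem_antidiagonal] at hab
    refine if_neg fun h => hne ?_
    simp only at h hab
    ext <;> simp only <;> omega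
  · intro hn
    exact absurd (HasAntidiagonal.mem_antidiagonal.2 hij) hn

theorem eq_zero_of_tripleGen_eq_zero {Z : ℕ → ℕ → ℕ → ℚ} {n : ℕ}
    (h : ∀ x y z, tripleGen Z n x y z = 0) {i j k : ℕ} (hn : i + (j + k) = n) : Z i j k = 0 := by
  have h1 : ∀ y z : ℚ, ∑ v ∈ antidiagonal (j + k), Z i v.1 v.2 * (y ^ v.1 * z ^ v.2) = 0 :=
    fun y z => eq_zero_of_sum_antidiagonal
      (c := fun a b => ∑ v ∈ antidiagonal b, Z a v.1 v.2 * (y ^ v.1 * z ^ v.2))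
      (fun x => by
        rw [← h x y z, tripleGen]
        refine sum_congr rfl fun u _ => ?_
        rw [sum_mul]
        exact sum_congr rfl fun v _ => by ring) hn
  -- By homogeneity, setting z = 1 loses nothing.
  exact eq_zero_of_sum_antidiagonal (c := fun a b => Z i a b)
    (fun y => by simpa using h1 y 1) rfl

theorem tripleGen_neg (Z : ℕ → ℕ → ℕ → ℚ) {n : ℕ} (hn : Odd n) (x y z : ℚ) :
    tripleGen Z n (-x) (-y) (-z) = -tripleGen Z n x y z := by
  rw [tripleGen, tripleGen, ← sum_neg_distrib]
  refine sum_congr rfl fun u hu => ?_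
  rw [← sum_neg_distrib]
  refine sum_congr rfl fun v hv => ?_
  rw [HasAntidiagonal.mem_antidiagonal] at hu hv
  have h : (-1 : ℚ) ^ u.1 * (-1) ^ v.1 * (-1) ^ v.2 = -1 := by
    rw [← pow_add, ← pow_add, add_assoc, hv, hu, hn.neg_one_pow]
  rw [neg_pow x, neg_pow y, neg_pow z]
  linear_combination Z u.1 v.1 v.2 * (x ^ u.1 * y ^ v.1 * z ^ v.2) * h

theorem tripleGen_rotate (Z : ℕ → ℕ → ℕ → ℚ) (n : ℕ) (x y z : ℚ) :
    tripleGen Z n y z x = tripleGen (fun i j k => Z j k i) n x y z := by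
  simp only [tripleGen, sum_sigma']
  refine sum_nbij' (fun t => ⟨(t.2.2, t.1.1 + t.2.1), (t.1.1, t.2.1)⟩)
    (fun t => ⟨(t.2.1, t.2.2 + t.1.1), (t.2.2, t.1.1)⟩) ?_ ?_ ?_ ?_ ?_
  all_goals
    rintro ⟨⟨a, b⟩, ⟨c, d⟩⟩ h
    simp only [mem_sigma, HasAntidiagonal.mem_antidiagonal] at h
    obtain ⟨h1, h2⟩ := h
    try simp only at h1 h2
    subst h1 h2
  · simp [add_comm, add_left_comm]
  · simp [add_comm, add_left_comm]
  · rfl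
  · rfl
  · ring

theorem tripleGen_swap (Z : ℕ → ℕ → ℕ → ℚ) (n : ℕ) (x y z : ℚ) :
    tripleGen Z n y x z = tripleGen (fun i j k => Z j i k) n x y z := by
  simp only [tripleGen, sum_sigma']
  refine sum_nbij' (fun t => ⟨(t.2.1, t.1.1 + t.2.2), (t.1.1, t.2.2)⟩)
    (fun t => ⟨(t.2.1, t.1.1 + t.2.2), (t.1.1, t.2.2)⟩) ?_ ?_ ?_ ?_ ?_
  all_goals
    rintro ⟨⟨a, b⟩, ⟨c, d⟩⟩ h
    simp only [mem_sigma, HasAntidiagonal.mem_antidiagonal] at h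
    obtain ⟨h1, h2⟩ := h
    try simp only at h1 h2
    subst h1 h2
  · simp [add_left_comm]
  · simp [add_left_comm]
  · rfl
  · rfl
  · ring

/-! ### The parity argument. -/

/-- Parity: an odd function satisfying the linearised stuffle relation and the linearised shuffle
relation up to a term independent of `y` vanishes. -/
theorem eq_zero_of_linearized_double_shuffle {T : ℚ → ℚ → ℚ → ℚ}
    (hodd : ∀ x y z, T (-x) (-y) (-z) = -T x y z)
    (hst : ∀ x y z, T x y z + T y x z + T y z x = 0)
    (hsh : ∀ x y z, T (x + y) y z + T (x + y) (x + z) z + T (x + y) (x + z) x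
      = T x 0 z + T x (x + z) z + T x (x + z) x) (x y z : ℚ) : T x y z = 0 := by
  obtain ⟨β, sh⟩ : ∃ β : ℚ → ℚ → ℚ, ∀ x y z, T (x + y + z) (y + z) z + T (x + y + z) (x + z) z
      + T (x + y + z) (x + z) x = β x z := ⟨_, fun x y z => by
    have := hsh x (y + z) z
    rwa [← add_assoc] at this⟩
  have hβodd : ∀ x z, β (-x) (-z) = -β x z := fun x z => by
    rw [← sh x 0 z, ← sh (-x) 0 (-z)]
    have h1 := hodd (x + 0 + z) (0 + z) z
    have h2 := hodd (x + 0 + z) (x + z) z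
    have h3 := hodd (x + 0 + z) (x + z) x
    ring_nf at h1 h2 h3 ⊢
    linear_combination h1 + h2 + h3
  obtain ⟨b, hb, hβ⟩ : ∃ b : ℚ → ℚ, (∀ x, b (-x) = -b x) ∧ ∀ x z, β x z = b z + b x / 2 := by
    -- Each side sums T(x+y+z, u+v, v) over all ordered pairs of distinct variables u, v, hence the
    -- symmetry.
    have h : ∀ x y z, β x z + β x y = β y z + β y x := fun x y z => by
      rw [← sh x y z, ← sh x z y, ← sh y x z, ← sh y z x]
      ring_nf
    have h0 : β 0 0 = 0 := by
      have := hβodd 0 0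
      simp only [neg_zero] at this
      linarith
    refine ⟨β 0, fun x => by simpa using hβodd 0 x, fun x z => ?_⟩
    linarith [h 0 x z, h 0 x 0]
  have key : ∀ x y z, -2 * T x y z = b (x - y) + b (z - y) := fun x y z => by
    have h0 : T x y (y - z) + T x (x - z) (y - z) + T x (x - z) (x - y) = β (x - y) (y - z) := by
      rw [← sh (x - y) z (y - z)]; ring_nf
    have h1 : T x (x - z) (y - z) + T x y (y - z) + T x y z = β z (y - z) := by
      rw [← sh z (x - y) (y - z)]; ring_nf
    have h2 : T (-y) (-x) (-z) + T (-y) (x - y - z) (-z) + T (-y) (x - y - z) (x - y) = β (x - y) (-z) := by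
      rw [← sh (x - y) (z - x) (-z)]; ring_nf
    have h3 : T (-y) (z - y) (x - y) + T (-y) (x - y - z) (x - y) + T (-y) (x - y - z) (-z) = β (-z) (x - y) := by
      rw [← sh (-z) (z - x) (x - y)]; ring_nf
    have h4 : T (x - y) (-y) (-z) + T (x - y) (x - z) (-z) + T (x - y) (x - z) x = β x (-z) := by
      rw [← sh x (z - y) (-z)]; ring_nf
    have h5 : T (x - y) (x - z) (-z) + T (x - y) (-y) (-z) + T (x - y) (-y) (z - y) = β (z - y) (-z) := by
      rw [← sh (z - y) x (-z)]; ring_nf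
    have h6 : T (-y) (-z) (x - z) + T (-y) (x - y) (x - z) + T (-y) (x - y) (z - y) = β (z - y) (x - z) := by
      rw [← sh (z - y) (-x) (x - z)]; ring_nf
    have h7 : T (-y) (x - y) (x - z) + T (-y) (-z) (x - z) + T (-y) (-z) (-x) = β (-x) (x - z) := by
      rw [← sh (-x) (z - y) (x - z)]; ring_nf
    have s0 := hst (x - y) (-y) (z - y)
    have s1 := hst x (x - y) (x - z)
    have s2 := hst (x - y) x (x - z)
    have s3 := hst (-x) (-y) (-z)
    have n := hodd x y z
    simp only [hβ, hb] at h0 h1 h2 h3 h4 h5 h6 h7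
    -- Within each pair (h0,h1), (h2,h3), (h4,h5), (h6,h7) two values of T cancel. Of the rest, s0
    -- removes three, s1 − s2 two, and s3 with oddness turns two into −T(x,y,z), joining the
    -- −T(x,y,z) from h1.
    linear_combination h0 - h1 - h2 + h3 - h4 + h5 + h6 - h7 - s0 + s1 - s2 + s3 - n
  have hb0 : ∀ t, b t = 0 := fun t => by
    have b0 : b 0 = 0 := by
      have := hb 0
      rw [neg_zero] at this
      linarith
    -- At x = 0 the shuffle relation, rewritten by `key`, involves b alone; z = 0 then gives b = 0.
    have e : ∀ y z, b (y - z) - b z = -2 * (b z + b 0 / 2) := fun y z => by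
      have h : T y y z + T y z z + T y z 0 = β 0 z := by
        rw [← sh 0 (y - z) z]; ring_nf
      have k1 := key y y z
      have k2 := key y z z
      have k3 := key y z 0
      have b1 : b (z - y) = -b (y - z) := by rw [← hb, neg_sub]
      simp only [sub_self, zero_sub, hb, b0] at k1 k2 k3
      rw [← hβ, ← h]
      linear_combination -k1 - k2 - k3 - b1
    have := e t 0
    rw [sub_zero, b0] at this
    linarith
  have := key x y z
  rw [hb0, hb0] at this
  linarith

/-! ### Regularization. -/

/-- Extension of `z i j k` from `1 ≤ i` to `i = 0` forced by the stuffle relations. -/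
def regularized (z : ℕ → ℕ → ℕ → ℚ) : ℕ → ℕ → ℕ → ℚ
  -- For k ≥ 1, stuffle reads 2·(0,0,k) + (0,k,0) = 0, and (0,k,0) is −2 `z k 0 0`.
  | 0, 0, k => z k 0 0
  | 0, j + 1, k => -(z (j + 1) 0 k + z (j + 1) k 0)
  | i + 1, j, k => z (i + 1) j k

theorem regularized_of_pos (z : ℕ → ℕ → ℕ → ℚ) {i : ℕ} (hi : 1 ≤ i) (j k : ℕ) :
    regularized z i j k = z i j k := by
  obtain ⟨i, rfl⟩ := Nat.exists_eq_add_of_le' hi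
  rfl

theorem IsDoubleShuffle.regularized_stuffle {z : ℕ → ℕ → ℕ → ℚ} (H : IsDoubleShuffle z)
    {s p q : ℕ} (h : 1 ≤ s + p + q) :
    regularized z s p q + regularized z p s q + regularized z p q s = 0 := by
  rcases s with _ | s <;> rcases p with _ | p
  · rcases q with _ | q
    · omega
    · simp only [regularized]; ring
  · simp only [regularized]; ring
  · rcases q with _ | q
    · simp only [regularized]; ring
    · simp only [regularized]
      linear_combination -H.stuffle (s + 1) (q + 1) 0 (by omega) (by omega)
  · simp only [regularized]
    linear_combination H.stuffle (s + 1) (p + 1) q (by omega) (by omega)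

theorem splitValue_regularized (z : ℕ → ℕ → ℕ → ℚ) (a c : ℕ) {g : ℕ} (hg : 1 ≤ g) :
    splitValue (regularized z) a c g = splitValue z a c g := by
  simp only [splitValue, regularized_of_pos z hg]

/-- For s = 0 the regularized term with first index 0 supplies the right side of Hoffman's relation.
The uncontrolled case of second index 0 contributes only terms free of y. -/
theorem IsDoubleShuffle.regularized_shuffle {z : ℕ → ℕ → ℕ → ℚ} (H : IsDoubleShuffle z)
    (s p q : ℕ) : shuffleValue (regularized z) s (p + 1) q 0 = 0 := by
  rcases s with _ | s
  · have h := H.hoffman p q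
    simp only [shuffleValue, Nat.antidiagonal_succ, Nat.antidiagonal_zero, sum_cons, sum_map,
      sum_singleton, splitValue_regularized z q 0 (show 1 ≤ p + 1 + 0 + 0 by omega)] at h ⊢
    simp only [zero_add, add_zero, Nat.choose_self, Nat.cast_one, one_mul, Nat.choose_zero_right,
      Function.Embedding.prodMap, Function.Embedding.coeFn_mk, Prod.map,
      Function.Embedding.refl_apply, regularized, Nat.succ_eq_add_one] at h ⊢
    linear_combination h
  · rw [← H.shuffle (s + 1) (p + 1) q (by omega) (by omega), shuffleValue, shuffleValue]
    congr 1 <;> refine sum_congr rfl fun i _ => ?_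
    · rw [regularized_of_pos z (by omega)]
    · rw [splitValue_regularized z _ _ (by omega)]

theorem IsDoubleShuffle.eq_zero_of_odd {z : ℕ → ℕ → ℕ → ℚ} (H : IsDoubleShuffle z) {i j k : ℕ}
    (hi : 1 ≤ i) (hn : Odd (i + j + k)) : z i j k = 0 := by
  rw [← regularized_of_pos z hi]
  refine eq_zero_of_tripleGen_eq_zero (n := i + j + k) (fun x y z' =>
    eq_zero_of_linearized_double_shuffle (tripleGen_neg _ hn) ?_ ?_ x y z') (by ring)
  · intro x y w
    rw [tripleGen_swap _ _ x y w, tripleGen_rotate _ _ x y w]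
    simp only [tripleGen, ← sum_add_distrib, ← add_mul]
    refine sum_eq_zero fun u hu => sum_eq_zero fun v hv => ?_
    rw [HasAntidiagonal.mem_antidiagonal] at hu hv
    rw [H.regularized_stuffle (by omega), zero_mul]
  · intro x y w
    have h := tripleGen_shuffle (regularized z) (i + j + k) x 0 w
    rw [add_zero] at h
    rw [tripleGen_shuffle, h]
    refine sum_congr rfl fun u _ => sum_congr rfl fun v _ => ?_
    rcases v with ⟨_ | p, q⟩
    · simp
    · simp [H.regularized_shuffle]

/-! ### Passage to a linear functional and conclusion. -/

theorem map_splitValue (φ : ℝ →ₗ[ℚ] ℚ) (Z : ℕ → ℕ → ℕ → ℝ) (a c g : ℕ) :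
    φ (splitValue Z a c g) = splitValue (fun i j k => φ (Z i j k)) a c g := by
  simp only [splitValue, map_add, map_sum, ← nsmul_eq_mul, map_nsmul]

theorem map_shuffleValue (φ : ℝ →ₗ[ℚ] ℚ) (Z : ℕ → ℕ → ℕ → ℝ) (s p q f : ℕ) :
    φ (shuffleValue Z s p q f) = shuffleValue (fun i j k => φ (Z i j k)) s p q f := by
  simp only [shuffleValue, map_add, map_sum, ← nsmul_eq_mul, map_nsmul, map_splitValue]

theorem doubleEulerSum_mem {p : ℕ} (hp : 1 ≤ p) (q : ℕ) :
    doubleEulerSum (p + 1) (q + 1) ∈ eulerCombinations :=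
  Submodule.subset_span (Subsemigroup.subset_closure
    (Or.inr ⟨p + 1, q + 1, by omega, by omega, rfl⟩))

theorem single_mul_double_mem {s p : ℕ} (hs : 1 ≤ s) (hp : 1 ≤ p) (q : ℕ) :
    singleEulerSum (s + 1) * doubleEulerSum (p + 1) (q + 1) ∈ eulerCombinations :=
  Submodule.subset_span (mul_mem
    (Subsemigroup.subset_closure (Or.inl ⟨s + 1, by omega, rfl⟩))
    (Subsemigroup.subset_closure (Or.inr ⟨p + 1, q + 1, by omega, by omega, rfl⟩)))

theorem isDoubleShuffle_of_le_ker {φ : ℝ →ₗ[ℚ] ℚ} (hφ : eulerCombinations ≤ LinearMap.ker φ) :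
    IsDoubleShuffle fun i j k => φ (tripleZeta i j k) where
  stuffle s p q hs hp := by
    have h := congrArg φ (single_mul_double_eq_stuffle hs hp q)
    have h0 : φ _ = 0 := hφ (single_mul_double_mem hs hp q)
    have h1 : φ _ = 0 := hφ (doubleEulerSum_mem hp (q + s + 1))
    have h2 : φ _ = 0 := hφ (doubleEulerSum_mem (p := p + s + 1) (by omega) q)
    simp only [map_add, h0, h1, h2] at h
    linear_combination -h
  shuffle s p q hs hp := by
    rw [← map_shuffleValue, ← single_mul_double_eq_shuffle hs hp]
    exact hφ (single_mul_double_mem hs hp q)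
  hoffman p q := by
    have h := congrArg φ (hoffman_relation p q)
    have h1 : φ _ = 0 := hφ (doubleEulerSum_mem (p := p + 1) (by omega) (q + 1))
    have h2 : φ _ = 0 := hφ (doubleEulerSum_mem (p := p + 2) (by omega) q)
    simp only [map_add, h1, h2, map_shuffleValue, map_zero] at h
    linear_combination h

theorem tripleZeta_mem {i j k : ℕ} (hi : 1 ≤ i) (hw : Odd (i + j + k) ∨ i + j + k ≤ 7) :
    tripleZeta i j k ∈ eulerCombinations := by
  by_contra hn
  obtain ⟨φ, hne, hφ⟩ := Submodule.exists_le_ker_of_notMem hn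
  have H := isDoubleShuffle_of_le_ker hφ
  refine hne ?_
  rcases Nat.even_or_odd (i + j + k) with he | ho
  · have h7 : i + j + k ≤ 7 := hw.resolve_left (Nat.not_odd_iff_even.2 he)
    obtain ⟨r, hr⟩ := he
    obtain h | h | h : i + j + k = 2 ∨ i + j + k = 4 ∨ i + j + k = 6 := by omega
    · exact H.weight_five hi h
    · exact H.weight_seven hi h
    · exact H.weight_nine hi h
  · exact H.eq_zero_of_odd hi ho

theorem natCast_mul_mem (n : ℕ) {x : ℝ} (hx : x ∈ eulerCombinations) :
    (n : ℝ) * x ∈ eulerCombinations := by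
  rw [← nsmul_eq_mul]
  exact nsmul_mem hx n

theorem splitValue_mem {a c g : ℕ} (hg : 1 ≤ g) (hw : Odd (a + c + g) ∨ a + c + g ≤ 7) :
    splitValue tripleZeta a c g ∈ eulerCombinations := by
  refine add_mem (sum_mem fun k hk => natCast_mul_mem _ (tripleZeta_mem hg ?_))
    (sum_mem fun k hk => natCast_mul_mem _ (tripleZeta_mem hg ?_))
  all_goals
    rw [HasAntidiagonal.mem_antidiagonal] at hk
    convert hw using 2 <;> omega

theorem shuffleValue_mem {s p q f : ℕ} (hs : 1 ≤ s + f) (hp : 1 ≤ p + f)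
    (hw : Odd (s + p + q + f) ∨ s + p + q + f ≤ 7) :
    shuffleValue tripleZeta s p q f ∈ eulerCombinations := by
  refine add_mem (sum_mem fun k hk => natCast_mul_mem _ (tripleZeta_mem (by omega) ?_))
    (sum_mem fun k hk => natCast_mul_mem _ (splitValue_mem (by omega) ?_))
  all_goals
    rw [HasAntidiagonal.mem_antidiagonal] at hk
    convert hw using 2 <;> omega

theorem theorem2p2 (a b c d f : ℕ) (ha : 0 < a) (hb : 0 < b) (hc : 0 < c) (hd : 0 < d)
    (hf : 0 < f) (hw : Even (a + b + c + d + f) ∨ a + b + c + d + f ≤ 10) :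
    Summable (wittenSl4Term a b c d 0 f) ∧
      wittenSl4 a b c d 0 f ∈ eulerCombinations := by
  obtain ⟨a, rfl⟩ := Nat.exists_eq_add_of_le' ha
  obtain ⟨b, rfl⟩ := Nat.exists_eq_add_of_le' hb
  obtain ⟨c, rfl⟩ := Nat.exists_eq_add_of_le' hc
  obtain ⟨d, rfl⟩ := Nat.exists_eq_add_of_le' hd
  obtain ⟨f, rfl⟩ := Nat.exists_eq_add_of_le' hf
  have h := hasSum_witten a b c d f
  -- After the shift, triple sums have index sum equal to the weight minus 3, which flips parity and
  -- turns 10 into 7.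
  have hw' : Odd (a + b + c + d + f + 2) ∨ a + b + c + d + f + 2 ≤ 7 := by
    rcases hw with ⟨r, hr⟩ | hw
    · exact Or.inl ⟨r - 2, by omega⟩
    · exact Or.inr (by omega)
  refine ⟨h.summable, ?_⟩
  rw [wittenSl4, h.tsum_eq]
  refine add_mem (sum_mem fun k hk => natCast_mul_mem _ (shuffleValue_mem (by omega) (by omega) ?_))
    (sum_mem fun k hk => natCast_mul_mem _ (shuffleValue_mem (by omega) (by omega) ?_))
  all_goals
    rw [HasAntidiagonal.mem_antidiagonal] at hk
    convert hw' using 2 <;> omega
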